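/- Let $k$ be a commutative ring and $G$ a group. Let $\mathrm{FI}_G$ be the category whose objects are the finite sets $[n]=\{1,\dots,n\}$, $n\ge 0$, and whose morphisms $[m]\to[n]$ are pairs $(f,g)$ of an injection $f:[m]\to[n]$ and a map of sets $g:[m]\to G$, with composition $(f,g)\circ(f',g')=(f\circ f',h)$, $h(x)=g'(x)\,g(f'(x))$. Let $\mathrm{FB}_G$ be the subcategory with the same objects and with those morphisms $(f,g)$ for which $f$ is a bijection. An $\mathrm{FI}_G$-module (resp. $\mathrm{FB}_G$-module) over $k$ is a covariant functor from $\mathrm{FI}_G$ (resp. $\mathrm{FB}_G$) to $k$-modules; write $V_n=V([n])$. Let $H_0$ be the functor from $\mathrm{FI}_G$-modules to $\mathrm{FB}_G$-modules for which $H_0(V)_n$ is the quotient of $V_n$ by the submodule spanned by the images of all maps $V_m\to V_n$ induced by morphisms $[m]\to[n]$ with $m<n$, and for $i\ge 0$ let $H_i$ be the $i$-th left derived functor of $H_0$. For an $\mathrm{FB}_G$-module $W$ put $\deg(W)=\sup\{n : W_n\ne 0\}\in\mathbb{N}\cup\{-\infty,\infty\}$, with $\sup\emptyset=-\infty$. The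 regularity $\operatorname{reg}(V)$ of an $\mathrm{FI}_G$-module $V$ is the smallest $N\in\mathbb{Z}\cup\{-\infty,\infty\}$ such that $\deg(H_i(V))-i\le N$ for all $i\ge 1$. Let $V$ be an $\mathrm{FI}_G$-module over $k$, and let $d,r$ be integers such that $V$ has generating degree $\le d$, i.e. $\deg(H_0(V))\le d$, and first homological degree $\le r$, i.e. $\deg(H_1(V))\le r$. Then $$\operatorname{reg}(V)\le r+\min\{r,d\}-1.$$ -/

import Mathlib

open CategoryTheory CategoryTheory.Limits

universe u v w

namespace FIG

/-- The objects of `FI_G` (in its skeletal form): the finite sets `[n]`, `n = 0, 1, 2, …`,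
where `[n]` is modelled by `Fin n`. -/
@[ext]
structure FI (G : Type v) : Type where
  /-- the number of elements -/
  card : ℕ

/-- A morphism `[m] ⟶ [n]` of `FI_G`: an injection together with a map of sets `[m] → G`. -/
@[ext]
structure FIHom (G : Type v) (m n : ℕ) : Type v where
  /-- the underlying injection -/
  inj : Fin m ↪ Fin n
  /-- the `G`-labels -/
  lab : Fin m → G

/-- The category `FI_G`. The composite of `(f', g')` followed by `(f, g)` is `(f ∘ f', h)` with
`h x = g' x * g (f' x)`. -/
instance FI.category (G : Type v) [Group G] : Category.{v} (FI G) where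
  Hom m n := FIHom G m.card n.card
  id m := ⟨Function.Embedding.refl _, fun _ => 1⟩
  comp a b := ⟨a.inj.trans b.inj, fun x => a.lab x * b.lab (a.inj x)⟩
  id_comp a := by
    apply FIHom.ext
    · rfl
    · funext x
      exact one_mul _
  comp_id a := by
    apply FIHom.ext
    · rfl
    · funext x
      exact mul_one _
  assoc a b c := by
    apply FIHom.ext
    · rfl
    · funext x
      exact mul_assoc _ _ _

/-- The objects of `FB_G`: again the finite sets `[n]`. -/
@[ext]
structure FB (G : Type v) : Type where
  /-- the number of elements -/
  card : ℕ

/-- The category `FB_G`: the subcategory of `FI_G` with the same objects, whose morphisms are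
the pairs `(f, g)` with `f` a bijection. -/
instance FB.category (G : Type v) [Group G] : Category.{v} (FB G) where
  Hom m n := {a : (FI.mk m.card : FI G) ⟶ FI.mk n.card // Function.Bijective a.inj}
  id m := ⟨𝟙 (FI.mk m.card : FI G), Function.bijective_id⟩
  comp a b := ⟨a.1 ≫ b.1, b.2.comp a.2⟩
  id_comp a := Subtype.ext (Category.id_comp a.1)
  comp_id a := Subtype.ext (Category.comp_id a.1)
  assoc a b c := Subtype.ext (Category.assoc a.1 b.1 c.1)

/-- `FI_G`-modules over `k`: covariant functors from `FI_G` to `k`-modules. -/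
abbrev FIMod (k : Type u) [CommRing k] (G : Type v) [Group G] :=
  FI G ⥤ ModuleCat.{max u v w} k

/-- `FB_G`-modules over `k`: covariant functors from `FB_G` to `k`-modules. -/
abbrev FBMod (k : Type u) [CommRing k] (G : Type v) [Group G] :=
  FB G ⥤ ModuleCat.{max u v w} k

section Homology

variable {k : Type u} [CommRing k] {G : Type v} [Group G]

/-- `V_{<n}`, the submodule of `V_n` spanned by the images of all maps `V_i → V_n` induced by
morphisms `[i] ⟶ [n]` with `i < n`. -/
def lower (V : FIMod.{u, v, w} k G) (n : ℕ) : Submodule k (V.obj ⟨n⟩) :=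
  ⨆ (i : ℕ) (_ : i < n) (a : (FI.mk i : FI G) ⟶ FI.mk n), LinearMap.range (V.map a).hom

lemma lower_le_comap_map (V : FIMod.{u, v, w} k G) {m n : ℕ}
    (a : (FI.mk m : FI G) ⟶ FI.mk n) :
    lower V m ≤ (lower V n).comap (V.map a).hom := by
  have hmn : m ≤ n := by simpa using Fintype.card_le_of_embedding a.inj
  refine iSup_le fun i => iSup_le fun hi => iSup_le fun b => ?_
  rintro _ ⟨x, rfl⟩
  refine Submodule.mem_iSup_of_mem i (Submodule.mem_iSup_of_mem (lt_of_lt_of_le hi hmn)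
    (Submodule.mem_iSup_of_mem (b ≫ a) ⟨x, ?_⟩))
  simp

lemma lower_le_comap_app {V W : FIMod.{u, v, w} k G} (φ : V ⟶ W) (n : ℕ) :
    lower V n ≤ (lower W n).comap (φ.app ⟨n⟩).hom := by
  refine iSup_le fun i => iSup_le fun hi => iSup_le fun b => ?_
  rintro _ ⟨x, rfl⟩
  refine Submodule.mem_iSup_of_mem i (Submodule.mem_iSup_of_mem hi
    (Submodule.mem_iSup_of_mem b ⟨(φ.app ⟨i⟩).hom x, ?_⟩))
  exact (NatTrans.naturality_apply φ b x).symm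

/-- The `FB_G`-module `H_0(V)`, with `H_0(V)_n = V_n / V_{<n}`. -/
def H0Obj (V : FIMod.{u, v, w} k G) : FBMod.{u, v, w} k G where
  obj n := ModuleCat.of k (V.obj ⟨n.card⟩ ⧸ lower V n.card)
  map a := ModuleCat.ofHom (Submodule.mapQ _ _ (V.map a.1).hom (lower_le_comap_map V a.1))
  map_id n := by
    ext x
    change Submodule.Quotient.mk ((V.map (𝟙 (FI.mk n.card : FI G))).hom x) = _
    rw [V.map_id]
    rfl
  map_comp a b := by
    ext x
    change Submodule.Quotient.mk ((V.map (a.1 ≫ b.1)).hom x) = _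
    rw [V.map_comp]
    rfl

variable (k G)

/-- The zeroth homology functor `H_0 : FI_G-Mod ⥤ FB_G-Mod`. -/
def H0 : FIMod.{u, v, w} k G ⥤ FBMod.{u, v, w} k G where
  obj V := H0Obj V
  map {V W} φ :=
    { app := fun n => ModuleCat.ofHom
        (Submodule.mapQ _ _ (φ.app ⟨n.card⟩).hom (lower_le_comap_app φ n.card))
      naturality := by
        intro m n a
        ext x
        obtain ⟨x, rfl⟩ := Submodule.Quotient.mk_surjective _ x
        exact congrArg Submodule.Quotient.mk (NatTrans.naturality_apply φ a.1 x) }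
  map_id V := by
    ext n x
    obtain ⟨x, rfl⟩ := Submodule.Quotient.mk_surjective _ x
    rfl
  map_comp φ ψ := by
    ext n x
    obtain ⟨x, rfl⟩ := Submodule.Quotient.mk_surjective _ x
    rfl

instance H0_additive : (H0.{u, v, w} k G).Additive where
  map_add {V W} φ ψ := by
    ext n x
    obtain ⟨x, rfl⟩ := Submodule.Quotient.mk_surjective _ x
    rfl

/-- `FI_G-Mod` has enough projectives, so that derived functors can be formed. -/
instance enoughProjectives : EnoughProjectives (FIMod.{u, v, w} k G) where
  presentation V := by
    let P : FI G → FIMod.{u, v, w} k G := fun n =>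
      (evaluationLeftAdjoint (ModuleCat.{max u v w} k) n).obj (Projective.over (V.obj n))
    let p : ∀ n, P n ⟶ V := fun n =>
      ((evaluationAdjunctionRight (ModuleCat.{max u v w} k) n).homEquiv _ _).symm
        (Projective.π (V.obj n))
    have hp : ∀ n, Projective (P n) := fun n =>
      (evaluationAdjunctionRight (ModuleCat.{max u v w} k) n).map_projective _ inferInstance
    have he : Epi (Sigma.desc p) := by
      have : ∀ n, Epi ((Sigma.desc p).app n) := fun n => by
        have h1 : ((evaluationAdjunctionRight (ModuleCat.{max u v w} k) n).homEquiv _ _) (p n)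
            = Projective.π (V.obj n) := Equiv.apply_symm_apply _ _
        rw [← Sigma.ι_desc p n, Adjunction.homEquiv_unit, Functor.map_comp] at h1
        have h2 : Epi ((((evaluationAdjunctionRight (ModuleCat.{max u v w} k) n).unit.app
            (Projective.over (V.obj n)) ≫ ((evaluation _ _).obj n).map (Sigma.ι P n))) ≫
            (Sigma.desc p).app n) := by
          rw [Category.assoc]
          erw [h1]
          infer_instance
        exact epi_of_epi ((evaluationAdjunctionRight (ModuleCat.{max u v w} k) n).unit.app
            (Projective.over (V.obj n)) ≫ ((evaluation _ _).obj n).map (Sigma.ι P n))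
          ((Sigma.desc p).app n)
      exact NatTrans.epi_of_epi_app _
    have hP : Projective (∐ P) :=
      { factors := fun {E X} f e _ => by
          refine ⟨Sigma.desc fun n => Projective.factorThru (Sigma.ι P n ≫ f) e, ?_⟩
          refine Sigma.hom_ext _ _ fun n => ?_
          simp }
    exact ⟨{ p := ∐ P, f := Sigma.desc p, projective := hP, epi := he }⟩

/-- The homology functors `H_i`: the left derived functors of `H_0`. -/
noncomputable def homology (i : ℕ) : FIMod.{u, v, w} k G ⥤ FBMod.{u, v, w} k G :=
  (H0.{u, v, w} k G).leftDerived i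

variable {k G}

/-- The degree of an `FB_G`-module, `sup {n | W_n ≠ 0}`; it is a natural number or `±∞`, and it
is `-∞` for the zero module. -/
noncomputable def degree (W : FBMod.{u, v, w} k G) : EReal :=
  ⨆ (n : ℕ) (_ : Nontrivial (W.obj ⟨n⟩)), (n : EReal)

/-- The generating degree of `V`: the degree of `H_0(V)`. -/
noncomputable def generatingDegree (V : FIMod.{u, v, w} k G) : EReal :=
  degree ((H0.{u, v, w} k G).obj V)

/-- The `i`-th homological degree `hd_i(V)`: the degree of `H_i(V)`. -/
noncomputable def homologicalDegree (V : FIMod.{u, v, w} k G) (i : ℕ) : EReal :=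
  degree ((homology.{u, v, w} k G i).obj V)

/-- The (Castelnuovo–Mumford) regularity of `V`: the smallest `N` with `hd_i(V) - i ≤ N` for all
`i ≥ 1`. -/
noncomputable def regularity (V : FIMod.{u, v, w} k G) : EReal :=
  ⨆ (i : ℕ) (_ : 1 ≤ i), (homologicalDegree V i - (i : EReal))

end Homology

end FIG

/-!
For an `FI_G`-module `V` let `SV` be the shift, `(SV)_n = V_{n+1}`, and let `KV` and `DV` be the
kernel and the cokernel of the natural map `V ⟶ SV`. Two facts drive the argument:

* `H_0(DV)_n = H_0(V)_{n+1}`, so that `H_0(V)_n = (D^n V)_0` (`lowerShift_eq`,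
  `derivProj_mem_lower`);
* `K` vanishes on projective modules and `D` preserves the class of (retracts of) free modules, so
  that `0 ⟶ Z ⟶ P ⟶ V ⟶ 0` with `P` projective yields `KV = ker (DZ ⟶ DP)`.

Say that `V` has torsion bound `ρ` if `K(D^a V)_n = 0` whenever `n + a > ρ`. By the second fact,
injectivity of `D^a Z ⟶ D^a P` propagates from `a` to `a + 1`, which shows that a torsion bound `ρ`
for `V` gives the torsion bound `ρ + 1` for its syzygy `Z` (`TorsionBound.syzygy`). By the first
fact, it also gives the injectivity of `H_0(Z)_n ⟶ H_0(P)_n`, that is, `H_1(V)_n = 0`, for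
`n > ρ + 1` (`TorsionBound.mem_lower`). Applied to the successive syzygies in a projective
resolution, this yields `H_p(V)_n = 0` for `n > ρ + p` and `p ≥ 1`, so `ρ` bounds the regularity
(`TorsionBound.subsingleton_homology`).

It remains to see that `r + min r d - 1` is a torsion bound for `V`
(`IsPresentation.torsionBound`), by induction on `d`. If `V` is generated in degrees `≤ d` and
`H_1(V)` lives in degrees `≤ r`, then for `DV` the same holds with `d - 1` and `r - 1`
(`IsPresentation.deriv`), so by induction `DV` has torsion bound `ρ - 2`, where
`ρ = r + min r d - 1`. In particular `H_2(DV)_n = 0` for `n > ρ`. Because of the exact sequence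
`0 ⟶ KV ⟶ V ⟶ SV ⟶ DV ⟶ 0`, and because the transition maps of `KV` are zero, so that
`H_0(KV) = KV`, it follows that `KV` vanishes in degrees `> ρ`
(`IsPresentation.eq_zero_of_toShift`), which completes the induction.
-/

namespace FIG

/-! ### Elements of `FI_G`-modules -/

section Elements

variable {k : Type u} [CommRing k] {G : Type v} [Group G]

lemma map_comp_hom (V : FIMod.{u, v, w} k G) {l m n : FI G} (a : l ⟶ m) (b : m ⟶ n)
    (x : V.obj l) : (V.map (a ≫ b)).hom x = (V.map b).hom ((V.map a).hom x) := by
  rw [V.map_comp]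
  rfl

lemma app_map {V W : FIMod.{u, v, w} k G} (φ : V ⟶ W) {m n : FI G} (a : m ⟶ n) (x : V.obj m) :
    (φ.app n).hom ((V.map a).hom x) = (W.map a).hom ((φ.app m).hom x) :=
  NatTrans.naturality_apply φ a x

lemma comp_app_hom {V W X : FIMod.{u, v, w} k G} (φ : V ⟶ W) (ψ : W ⟶ X) (n : FI G)
    (x : V.obj n) : ((φ ≫ ψ).app n).hom x = (ψ.app n).hom ((φ.app n).hom x) :=
  rfl

lemma app_surjective {V W : FIMod.{u, v, w} k G} (φ : V ⟶ W) [Epi φ] (n : FI G) :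
    Function.Surjective (φ.app n).hom :=
  (ModuleCat.epi_iff_surjective (φ.app n)).1 inferInstance

/-- A morphism of `FI_G` factors through another one as soon as the underlying injections do. -/
lemma exists_factor {i m n : ℕ} (b : (FI.mk i : FI G) ⟶ FI.mk n) (c : (FI.mk m : FI G) ⟶ FI.mk n)
    (h : ∀ x, ∃ y, c.inj y = b.inj x) : ∃ b' : (FI.mk i : FI G) ⟶ FI.mk m, b' ≫ c = b := by
  choose y hy using h
  refine ⟨⟨⟨y, fun x x' hx => b.inj.injective ?_⟩, fun x => b.lab x * (c.lab (y x))⁻¹⟩, ?_⟩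
  · rw [← hy, ← hy, hx]
  · apply FIHom.ext
    · ext x
      exact congrArg Fin.val (hy x)
    · funext x
      exact inv_mul_cancel_right _ _

lemma map_mem_lower (V : FIMod.{u, v, w} k G) {i n : ℕ} (hi : i < n)
    (a : (FI.mk i : FI G) ⟶ FI.mk n) (x : V.obj ⟨i⟩) : (V.map a).hom x ∈ lower V n :=
  Submodule.mem_iSup_of_mem i (Submodule.mem_iSup_of_mem hi (Submodule.mem_iSup_of_mem a ⟨x, rfl⟩))

lemma lower_le {V : FIMod.{u, v, w} k G} {n : ℕ} {N : Submodule k (V.obj ⟨n⟩)}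
    (h : ∀ i < n, ∀ (a : (FI.mk i : FI G) ⟶ FI.mk n) x, (V.map a).hom x ∈ N) : lower V n ≤ N := by
  refine iSup_le fun i => iSup_le fun hi => iSup_le fun a => ?_
  rintro _ ⟨x, rfl⟩
  exact h i hi a x

lemma app_mem_lower {V W : FIMod.{u, v, w} k G} (φ : V ⟶ W) {n : ℕ} {x : V.obj ⟨n⟩}
    (hx : x ∈ lower V n) : (φ.app ⟨n⟩).hom x ∈ lower W n :=
  lower_le_comap_app φ n hx

lemma lower_zero (V : FIMod.{u, v, w} k G) : lower V 0 = ⊥ :=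
  le_bot_iff.1 (lower_le fun _ hi => absurd hi (Nat.not_lt_zero _))

/-- If `φ` is surjective in degrees below `n`, then it maps `V_{<n}` onto `W_{<n}`. -/
lemma exists_lower_lift {V W : FIMod.{u, v, w} k G} (φ : V ⟶ W)
    (hφ : ∀ n, Function.Surjective (φ.app n).hom) {n : ℕ} {y : W.obj ⟨n⟩} (hy : y ∈ lower W n) :
    ∃ x ∈ lower V n, (φ.app ⟨n⟩).hom x = y := by
  have : lower W n ≤ (lower V n).map (φ.app ⟨n⟩).hom := by
    refine lower_le fun i hi a y => ?_
    obtain ⟨x, rfl⟩ := hφ _ y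
    exact ⟨_, map_mem_lower V hi a x, app_map φ a x⟩
  exact this hy

end Elements

/-! ### The shift functor -/

section Shift

variable (G : Type v) [Group G]

/-- The endofunctor `[n] ↦ [n] ⊔ {*}` of `FI_G`; the added point is `0 : Fin (n + 1)`, and it
carries the label `1`. -/
def FI.shift : FI G ⥤ FI G where
  obj n := ⟨n.card + 1⟩
  map {m n} a := (⟨⟨Fin.cons 0 (Fin.succ ∘ a.inj), by
      rw [Fin.cons_injective_iff]
      exact ⟨by rintro ⟨x, hx⟩; exact Fin.succ_ne_zero _ hx,
        (Fin.succ_injective _).comp a.inj.injective⟩⟩, Fin.cons 1 a.lab⟩ :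
      FIHom G (m.card + 1) (n.card + 1))
  map_id n := by
    apply FIHom.ext
    · ext x
      refine Fin.cases ?_ (fun x => ?_) x <;> rfl
    · funext x
      refine Fin.cases ?_ (fun x => ?_) x <;> rfl
  map_comp a b := by
    apply FIHom.ext
    · ext x
      refine Fin.cases ?_ (fun x => ?_) x <;> rfl
    · funext x
      refine Fin.cases ?_ (fun x => ?_) x
      · exact (one_mul _).symm
      · rfl

variable {G}

/-- The standard inclusion of `[n]` into `[n] ⊔ {*}`. -/
def FI.incl (n : ℕ) : (FI.mk n : FI G) ⟶ FI.mk (n + 1) :=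
  (⟨⟨Fin.succ, Fin.succ_injective n⟩, fun _ => 1⟩ : FIHom G n (n + 1))

lemma FI.incl_shift {m n : ℕ} (a : (FI.mk m : FI G) ⟶ FI.mk n) :
    FI.incl m ≫ (FI.shift G).map a = a ≫ FI.incl n := by
  apply FIHom.ext
  · ext x
    rfl
  · funext x
    exact (one_mul _).trans (mul_one _).symm

variable {k : Type u} [CommRing k]

/-- The shift `SV` of an `FI_G`-module, `(SV)_n = V_{n+1}`. -/
abbrev shiftMod (V : FIMod.{u, v, w} k G) : FIMod.{u, v, w} k G :=
  FI.shift G ⋙ V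

/-- The morphism `SV ⟶ SW` induced by `V ⟶ W`. -/
abbrev shiftMap {V W : FIMod.{u, v, w} k G} (φ : V ⟶ W) : shiftMod V ⟶ shiftMod W :=
  Functor.whiskerLeft (FI.shift G) φ

/-- The natural morphism `V ⟶ SV`. -/
def toShift (V : FIMod.{u, v, w} k G) : V ⟶ shiftMod V where
  app n := V.map (FI.incl n.card)
  naturality m n a := by
    ext x
    have h := congrArg (fun f => (V.map f).hom x) (FI.incl_shift a)
    exact (map_comp_hom V a (FI.incl n.card) x).symm.trans (h.symm.trans
      (map_comp_hom V (FI.incl m.card) ((FI.shift G).map a) x))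

lemma shiftMap_toShift {V W : FIMod.{u, v, w} k G} (φ : V ⟶ W) (n : FI G) (x : V.obj n) :
    ((shiftMap φ).app n).hom (((toShift V).app n).hom x) =
      ((toShift W).app n).hom ((φ.app n).hom x) :=
  app_map φ (FI.incl n.card) x

/-- The maps `V_i → V_n` with `i < n` kill the kernel of `V_i → V_{i+1}`: up to an automorphism
of `[i+1]`, all injections of `[i]` into a larger set factor through the standard inclusion. -/
lemma map_eq_zero_of_toShift {V : FIMod.{u, v, w} k G} {i n : ℕ} (hi : i < n)
    (a : (FI.mk i : FI G) ⟶ FI.mk n) {x : V.obj ⟨i⟩}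
    (hx : ((toShift V).app ⟨i⟩).hom x = 0) : (V.map a).hom x = 0 := by
  obtain ⟨t, ht⟩ : ∃ t, t ∉ Set.range a.inj := by
    by_contra! h
    have := Fintype.card_le_of_surjective a.inj h
    simp only [Fintype.card_fin] at this
    omega
  let c : (FI.mk (i + 1) : FI G) ⟶ FI.mk n :=
    (⟨⟨Fin.cons t a.inj, Fin.cons_injective_iff.2 ⟨ht, a.inj.injective⟩⟩, Fin.cons 1 a.lab⟩ :
      FIHom G (i + 1) n)
  have hc : FI.incl i ≫ c = a := by
    apply FIHom.ext
    · ext x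
      rfl
    · funext x
      exact one_mul _
  rw [← hc, map_comp_hom]
  exact (congrArg _ hx).trans (map_zero _)

/-- `V_{<n+1}`, regarded as a submodule of `(SV)_n = V_{n+1}`. -/
def lowerShift (V : FIMod.{u, v, w} k G) (n : ℕ) : Submodule k ((shiftMod V).obj ⟨n⟩) :=
  lower V (n + 1)

lemma toShift_mem_lowerShift (V : FIMod.{u, v, w} k G) {n : ℕ} (x : V.obj ⟨n⟩) :
    ((toShift V).app ⟨n⟩).hom x ∈ lowerShift V n :=
  map_mem_lower V (Nat.lt_succ_self n) (FI.incl n) x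

/-- `V_{<n+1}` is the sum of `(SV)_{<n}` and the image of `V_n`: an injection into `[n] ⊔ {*}`
that is not onto misses either `*` or a point of `[n]`. -/
lemma lowerShift_eq (V : FIMod.{u, v, w} k G) (n : ℕ) :
    lowerShift V n = lower (shiftMod V) n ⊔ LinearMap.range ((toShift V).app ⟨n⟩).hom := by
  apply le_antisymm
  · refine lower_le (V := V) (n := n + 1) (N := lower (shiftMod V) n ⊔
      LinearMap.range ((toShift V).app ⟨n⟩).hom) fun i hi b x => ?_
    obtain ⟨t, ht⟩ : ∃ t, t ∉ Set.range b.inj := by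
      by_contra! h
      have := Fintype.card_le_of_surjective b.inj h
      simp only [Fintype.card_fin] at this
      omega
    have key : ∀ {m : ℕ} (c : (FI.mk m : FI G) ⟶ FI.mk (n + 1)),
        (∀ s, s ≠ t → ∃ y, c.inj y = s) → ∃ b' : (FI.mk i : FI G) ⟶ FI.mk m,
          ∀ N : Submodule k ((shiftMod V).obj ⟨n⟩),
            (V.map c).hom ((V.map b').hom x) ∈ N → (V.map b).hom x ∈ N := fun c hc => by
      obtain ⟨b', rfl⟩ := exists_factor b c fun x => hc _ fun h => ht ⟨x, h⟩
      exact ⟨b', fun N h => map_comp_hom V b' c x ▸ h⟩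
    induction t using Fin.cases with
    | zero =>
      obtain ⟨b', hb'⟩ := key (FI.incl n) fun s hs => ⟨s.pred hs, Fin.succ_pred s hs⟩
      have h := LinearMap.mem_range_self ((toShift V).app ⟨n⟩).hom ((V.map b').hom x)
      exact hb' _ (le_sup_right (a := lower (shiftMod V) n) h)
    | succ t =>
      obtain _ | m := n
      · exact t.elim0
      let δ : (FI.mk m : FI G) ⟶ FI.mk (m + 1) := (⟨t.succAboveEmb, fun _ => 1⟩ : FIHom G m (m + 1))
      obtain ⟨b', hb'⟩ := key ((FI.shift G).map δ) fun s hs => by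
        induction s using Fin.cases with
        | zero => exact ⟨0, rfl⟩
        | succ s =>
          obtain ⟨y, hy⟩ := Fin.exists_succAbove_eq (x := s) (y := t) fun h => hs (h ▸ rfl)
          exact ⟨Fin.succ y, congrArg Fin.succ hy⟩
      have h := map_mem_lower (shiftMod V) (Nat.lt_succ_self m) δ ((V.map b').hom x)
      exact hb' _ (le_sup_left (b := LinearMap.range ((toShift V).app ⟨m + 1⟩).hom) h)
  · refine sup_le (lower_le (V := shiftMod V) fun i hi a x => ?_) ?_
    · exact map_mem_lower V (Nat.succ_lt_succ hi) ((FI.shift G).map a) x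
    · rintro _ ⟨x, rfl⟩
      exact toShift_mem_lowerShift V x

lemma mem_lowerShift {V : FIMod.{u, v, w} k G} {n : ℕ} {x : (shiftMod V).obj ⟨n⟩} :
    x ∈ lowerShift V n ↔
      ∃ y ∈ lower (shiftMod V) n, ∃ z, y + ((toShift V).app ⟨n⟩).hom z = x := by
  rw [lowerShift_eq, Submodule.mem_sup]
  exact ⟨fun ⟨y, hy, _, ⟨z, hz⟩, h⟩ => ⟨y, hy, z, hz ▸ h⟩, fun ⟨y, hy, z, h⟩ =>
    ⟨y, hy, _, ⟨z, rfl⟩, h⟩⟩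

end Shift

/-! ### The derivative -/

section Derivative

variable {k : Type u} [CommRing k] {G : Type v} [Group G]

lemma range_le_comap_shift (V : FIMod.{u, v, w} k G) {m n : FI G} (a : m ⟶ n) :
    LinearMap.range ((toShift V).app m).hom ≤
      (LinearMap.range ((toShift V).app n).hom).comap ((shiftMod V).map a).hom := by
  rintro _ ⟨x, rfl⟩
  exact ⟨(V.map a).hom x, app_map (toShift V) a x⟩

/-- The derivative `DV`, the cokernel of `V ⟶ SV`. -/
def deriv (V : FIMod.{u, v, w} k G) : FIMod.{u, v, w} k G where
  obj n := ModuleCat.of k ((shiftMod V).obj n ⧸ LinearMap.range ((toShift V).app n).hom)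
  map a := ModuleCat.ofHom (Submodule.mapQ _ _ ((shiftMod V).map a).hom (range_le_comap_shift V a))
  map_id n := by
    ext x
    change Submodule.Quotient.mk (((shiftMod V).map (𝟙 n)).hom x) = _
    rw [(shiftMod V).map_id]
    rfl
  map_comp a b := by
    ext x
    change Submodule.Quotient.mk (((shiftMod V).map (a ≫ b)).hom x) = _
    rw [(shiftMod V).map_comp]
    rfl

/-- The projection `SV ⟶ DV`. -/
def derivProj (V : FIMod.{u, v, w} k G) : shiftMod V ⟶ deriv V where
  app _ := ModuleCat.ofHom (Submodule.mkQ _)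
  naturality _ _ _ := rfl

lemma derivProj_surjective (V : FIMod.{u, v, w} k G) (n : FI G) :
    Function.Surjective ((derivProj V).app n).hom :=
  Submodule.mkQ_surjective _

lemma derivProj_eq_zero {V : FIMod.{u, v, w} k G} {n : FI G} {x : (shiftMod V).obj n} :
    ((derivProj V).app n).hom x = 0 ↔ ∃ y, ((toShift V).app n).hom y = x :=
  Submodule.Quotient.mk_eq_zero _

/-- The morphism `DV ⟶ DW` induced by `V ⟶ W`. -/
def derivMap {V W : FIMod.{u, v, w} k G} (φ : V ⟶ W) : deriv V ⟶ deriv W where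
  app n := ModuleCat.ofHom (Submodule.mapQ _ _ ((shiftMap φ).app n).hom (by
    rintro _ ⟨x, rfl⟩
    exact ⟨(φ.app n).hom x, (shiftMap_toShift φ n x).symm⟩))
  naturality m n a := by
    ext x
    obtain ⟨x, rfl⟩ := Submodule.Quotient.mk_surjective _ x
    exact congrArg Submodule.Quotient.mk (app_map (shiftMap φ) a x)

lemma derivMap_derivProj {V W : FIMod.{u, v, w} k G} (φ : V ⟶ W) (n : FI G)
    (x : (shiftMod V).obj n) : ((derivMap φ).app n).hom (((derivProj V).app n).hom x) =
      ((derivProj W).app n).hom (((shiftMap φ).app n).hom x) :=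
  rfl

/-- `H_0(DV)_n = H_0(V)_{n+1}`. -/
lemma derivProj_mem_lower {V : FIMod.{u, v, w} k G} {n : ℕ} {x : (shiftMod V).obj ⟨n⟩} :
    ((derivProj V).app ⟨n⟩).hom x ∈ lower (deriv V) n ↔ x ∈ lowerShift V n := by
  rw [mem_lowerShift]
  constructor
  · intro h
    obtain ⟨y, hy, hyx⟩ := exists_lower_lift (derivProj V) (derivProj_surjective V) h
    obtain ⟨z, hz⟩ := derivProj_eq_zero.1
      (show ((derivProj V).app ⟨n⟩).hom (x - y) = 0 by rw [map_sub, hyx, sub_self])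
    exact ⟨y, hy, z, by rw [hz]; abel⟩
  · rintro ⟨y, hy, z, rfl⟩
    rw [map_add, derivProj_eq_zero.2 ⟨z, rfl⟩, add_zero]
    exact app_mem_lower (derivProj V) hy

end Derivative

/-! ### Set-valued functors with supports -/

section Sets

/-- A set-valued functor on `FI_G` in which every element `x` of `X_n` has a support in `[n]`,
such that `x` comes from `X_m` along a morphism `a : [m] ⟶ [n]` as soon as the image of `a`
contains the support of `x`. The linearizations of these functors play the role of free
`FI_G`-modules; unlike the representable functors, they are visibly stable under shifts and
derivatives. -/
structure FISet (G : Type v) [Group G] where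
  /-- the sets `X_n` -/
  obj : FI G → Type w
  /-- the transition maps -/
  map : ∀ {m n : FI G}, (m ⟶ n) → obj m → obj n
  map_id : ∀ {n : FI G} (x : obj n), map (𝟙 n) x = x
  map_comp : ∀ {l m n : FI G} (a : l ⟶ m) (b : m ⟶ n) (x : obj l), map (a ≫ b) x = map b (map a x)
  map_injective : ∀ {m n : FI G} (a : m ⟶ n), Function.Injective (map a)
  /-- the support of an element -/
  supp : ∀ {n : FI G}, obj n → Set (Fin n.card)
  supp_map : ∀ {m n : FI G} (a : m ⟶ n) (x : obj m), supp (map a x) = a.inj '' supp x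
  exists_map_eq : ∀ {m n : FI G} (a : m ⟶ n) (x : obj n), supp x ⊆ Set.range a.inj →
    ∃ y, map a y = x

variable {G : Type v} [Group G]

lemma zero_mem_image_shift {m n : FI G} (a : m ⟶ n) (s : Set (Fin (m.card + 1))) :
    (0 : Fin (n.card + 1)) ∈ ((FI.shift G).map a).inj '' s ↔ 0 ∈ s := by
  constructor
  · rintro ⟨x, hx, h⟩
    induction x using Fin.cases with
    | zero => exact hx
    | succ x => exact absurd h (Fin.succ_ne_zero (a.inj x))
  · exact fun h => ⟨(0 : Fin (m.card + 1)), h, rfl⟩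

lemma succ_preimage_image_shift {m n : FI G} (a : m ⟶ n) (s : Set (Fin (m.card + 1))) :
    {i : Fin n.card | i.succ ∈ ((FI.shift G).map a).inj '' s} = a.inj '' {i | i.succ ∈ s} := by
  ext i
  constructor
  · rintro ⟨x, hx, h⟩
    induction x using Fin.cases with
    | zero => exact absurd h.symm (Fin.succ_ne_zero i)
    | succ x => exact ⟨x, hx, Fin.succ_injective _ h⟩
  · rintro ⟨x, hx, rfl⟩
    exact ⟨x.succ, hx, rfl⟩

lemma subset_range_shift {m n : FI G} (a : m ⟶ n) {s : Set (Fin (n.card + 1))}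
    (h : {i : Fin n.card | i.succ ∈ s} ⊆ Set.range a.inj) :
    s ⊆ Set.range ((FI.shift G).map a).inj := by
  intro x hx
  induction x using Fin.cases with
  | zero => exact ⟨(0 : Fin (m.card + 1)), rfl⟩
  | succ x =>
    obtain ⟨y, rfl⟩ := h hx
    exact ⟨y.succ, rfl⟩

/-- The support of an element of `X_{n+1}`, as a subset of `[n] ⊔ {*}`. -/
def FISet.suppShift (X : FISet.{v, w} G) {n : FI G} (x : X.obj ((FI.shift G).obj n)) :
    Set (Fin (n.card + 1)) :=
  X.supp (n := (FI.shift G).obj n) x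

lemma FISet.zero_mem_suppShift_map (X : FISet.{v, w} G) {m n : FI G} (a : m ⟶ n)
    (x : X.obj ((FI.shift G).obj m)) :
    0 ∈ X.suppShift (X.map ((FI.shift G).map a) x) ↔ 0 ∈ X.suppShift x := by
  rw [suppShift, X.supp_map]
  exact zero_mem_image_shift a _

/-- The inclusion of `X_n` into `X_{n+1}`. -/
def FISet.toShift (X : FISet.{v, w} G) {n : FI G} (x : X.obj n) : X.obj ((FI.shift G).obj n) :=
  X.map (FI.incl n.card) x

lemma FISet.supp_toShift (X : FISet.{v, w} G) {n : FI G} (x : X.obj n) :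
    X.suppShift (X.toShift x) = Fin.succ '' X.supp x :=
  X.supp_map (FI.incl n.card) x

/-- An element of `X_{n+1}` comes from `X_n` if its support does not contain the added point. -/
lemma FISet.exists_toShift_eq (X : FISet.{v, w} G) {n : FI G} {x : X.obj ((FI.shift G).obj n)}
    (h : 0 ∉ X.suppShift x) : ∃ y, X.toShift y = x := by
  refine X.exists_map_eq (FI.incl n.card) x fun s (hs : s ∈ X.suppShift x) => ?_
  change Fin (n.card + 1) at s
  induction s using Fin.cases with
  | zero => exact absurd hs h
  | succ s => exact ⟨s, rfl⟩

/-- The shift of a set-valued functor with supports. -/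
def FISet.shift (X : FISet.{v, w} G) : FISet.{v, w} G where
  obj n := X.obj ((FI.shift G).obj n)
  map a := X.map ((FI.shift G).map a)
  map_id {n} x := by
    rw [(FI.shift G).map_id]
    exact X.map_id x
  map_comp a b x := by
    rw [(FI.shift G).map_comp]
    exact X.map_comp _ _ x
  map_injective a := X.map_injective _
  supp x := {i | i.succ ∈ X.suppShift x}
  supp_map a x := by
    rw [suppShift, X.supp_map]
    exact succ_preimage_image_shift a _
  exists_map_eq a x h := X.exists_map_eq ((FI.shift G).map a) x (subset_range_shift a h)

/-- The derivative of a set-valued functor with supports: the elements of the shift that do not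
come from the original functor, that is, whose support contains the added point. -/
def FISet.deriv (X : FISet.{v, w} G) : FISet.{v, w} G where
  obj n := {x : X.shift.obj n // 0 ∈ X.suppShift x}
  map {m n} a x := ⟨X.shift.map a x.1, (X.zero_mem_suppShift_map a x.1).2 x.2⟩
  map_id x := Subtype.ext (X.shift.map_id x.1)
  map_comp a b x := Subtype.ext (X.shift.map_comp a b x.1)
  map_injective a x y h := Subtype.ext (X.shift.map_injective a (congrArg Subtype.val h))
  supp x := X.shift.supp x.1
  supp_map a x := X.shift.supp_map a x.1
  exists_map_eq {m n} a x h := by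
    obtain ⟨y, hy⟩ := X.shift.exists_map_eq a x.1 h
    exact ⟨⟨y, (X.zero_mem_suppShift_map a y).1 (hy ▸ x.2)⟩, Subtype.ext hy⟩

/-- The disjoint union of representable functors, one for each element of each `V_m`. -/
def FISet.generators (V : FI G → Type w) : FISet.{v, max v w} G where
  obj n := Σ m : FI G, (m ⟶ n) × V m
  map a x := ⟨x.1, x.2.1 ≫ a, x.2.2⟩
  map_id x := by rw [Category.comp_id]
  map_comp a b x := by rw [Category.assoc]
  map_injective {m n} a := by
    rintro ⟨l, b, x⟩ ⟨l', b', x'⟩ h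
    rw [Sigma.mk.injEq] at h
    obtain ⟨rfl, h⟩ := h
    rw [heq_eq_eq, Prod.mk.injEq] at h
    obtain ⟨h, rfl⟩ := h
    have : b = b' := by
      have hinj : ∀ y, b.inj y = b'.inj y := fun y =>
        a.inj.injective (congrArg (fun c : FIHom G l.card n.card => c.inj y) h)
      apply FIHom.ext
      · ext y
        exact congrArg Fin.val (hinj y)
      · funext y
        have hl : b.lab y * a.lab (b.inj y) = b'.lab y * a.lab (b'.inj y) :=
          congrArg (fun c : FIHom G l.card n.card => c.lab y) h
        rw [hinj] at hl
        exact mul_right_cancel hl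
    rw [this]
  supp x := Set.range x.2.1.inj
  supp_map a x := Set.range_comp a.inj x.2.1.inj
  exists_map_eq a x h := by
    obtain ⟨b, hb⟩ := exists_factor x.2.1 a fun y => h ⟨y, rfl⟩
    exact ⟨⟨x.1, b, x.2.2⟩, by rw [hb]⟩

end Sets

/-! ### Free modules -/

section Linearization

variable (k : Type u) [CommRing k] {G : Type v} [Group G]

/-- The `FI_G`-module spanned by a set-valued functor with supports. -/
noncomputable def FISet.lin (X : FISet.{v, max u v w} G) : FIMod.{u, v, w} k G where
  obj n := ModuleCat.of k (X.obj n →₀ k)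
  map a := ModuleCat.ofHom (Finsupp.lmapDomain k k (X.map a))
  map_id n := by
    refine ModuleCat.hom_ext (LinearMap.ext fun p => ?_)
    change Finsupp.mapDomain (X.map (𝟙 n)) p = p
    rw [show X.map (𝟙 n) = id from funext X.map_id, Finsupp.mapDomain_id]
  map_comp a b := by
    refine ModuleCat.hom_ext (LinearMap.ext fun p => ?_)
    change Finsupp.mapDomain (X.map (a ≫ b)) p =
      Finsupp.mapDomain (X.map b) (Finsupp.mapDomain (X.map a) p)
    rw [← Finsupp.mapDomain_comp]
    congr 1
    exact funext (X.map_comp a b)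

variable {k}

namespace FISet

variable (X : FISet.{v, max u v w} G)

/-- The multiple `c • x` of a basis element of the linearization. -/
noncomputable def single {n : FI G} (x : X.obj n) (c : k) :
    (X.lin k : FIMod.{u, v, w} k G).obj n :=
  Finsupp.single x c

lemma map_single {m n : FI G} (a : m ⟶ n) (x : X.obj m) (c : k) :
    ((X.lin k : FIMod.{u, v, w} k G).map a).hom (X.single x c) = X.single (X.map a x) c :=
  Finsupp.mapDomain_single

lemma toShift_single {n : FI G} (x : X.obj n) (c : k) :
    ((FIG.toShift (X.lin k : FIMod.{u, v, w} k G)).app n).hom (X.single x c) =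
      X.shift.single (X.toShift x) c :=
  X.map_single (FI.incl n.card) x c

variable {X} in
lemma lin_induction {n : FI G} {p : (X.lin k : FIMod.{u, v, w} k G).obj n → Prop} (zero : p 0)
    (add : ∀ x y, p x → p y → p (x + y)) (single : ∀ x c, p (X.single x c)) (x) : p x :=
  Finsupp.induction_linear x zero add single

variable {X} in
/-- The morphism out of a linearization given by a natural family of maps of sets. -/
noncomputable def desc {W : FIMod.{u, v, w} k G} (φ : ∀ n, X.obj n → W.obj n)
    (h : ∀ {m n : FI G} (a : m ⟶ n) x, φ n (X.map a x) = (W.map a).hom (φ m x)) :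
    X.lin k ⟶ W where
  app n := ModuleCat.ofHom (Finsupp.lsum k fun x => LinearMap.toSpanSingleton k _ (φ n x))
  naturality m n a := by
    refine ModuleCat.hom_ext (LinearMap.ext fun p => ?_)
    induction p using lin_induction with
    | zero => rw [map_zero, map_zero]
    | add x y hx hy => rw [map_add, map_add, hx, hy]
    | single x c =>
      change (Finsupp.lsum k fun x => LinearMap.toSpanSingleton k _ (φ n x))
        (Finsupp.mapDomain _ (Finsupp.single x c)) = (W.map a).hom
          ((Finsupp.lsum k fun x => LinearMap.toSpanSingleton k _ (φ m x)) (Finsupp.single x c))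
      rw [Finsupp.mapDomain_single, Finsupp.lsum_single, Finsupp.lsum_single,
        LinearMap.toSpanSingleton_apply, LinearMap.toSpanSingleton_apply, h, map_smul]

lemma desc_single {W : FIMod.{u, v, w} k G} (φ : ∀ n, X.obj n → W.obj n)
    (h : ∀ {m n : FI G} (a : m ⟶ n) x, φ n (X.map a x) = (W.map a).hom (φ m x)) {n : FI G}
    (x : X.obj n) (c : k) : ((desc φ h).app n).hom (X.single x c) = c • φ n x :=
  Finsupp.lsum_single _ _ _ _

end FISet

/-- `V_{<n}` of a linearization is spanned by the elements whose support is not all of `[n]`. -/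
lemma FISet.mem_lower_lin {X : FISet.{v, max u v w} G} {n : ℕ} {p : X.obj ⟨n⟩ →₀ k} :
    p ∈ lower (X.lin k : FIMod.{u, v, w} k G) n ↔ ∀ x ∈ p.support, X.supp x ≠ Set.univ := by
  classical
  constructor
  · intro hp
    suffices lower (X.lin k : FIMod.{u, v, w} k G) n ≤
        Finsupp.supported k k {x : X.obj ⟨n⟩ | X.supp x ≠ Set.univ} from this hp
    refine lower_le (V := X.lin k) fun i hi a p x hx => ?_
    obtain ⟨y, -, rfl⟩ := Finset.mem_image.1 (Finsupp.mapDomain_support hx)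
    rw [Set.mem_ofPred_eq, X.supp_map]
    intro h
    have := Fintype.card_le_of_surjective a.inj fun t => by
      obtain ⟨s, -, hs⟩ := h.symm ▸ Set.mem_univ t
      exact ⟨s, hs⟩
    simp only [Fintype.card_fin] at this
    omega
  · intro h
    rw [← p.sum_single]
    refine Submodule.sum_mem _ fun x hx => ?_
    obtain ⟨t, ht⟩ := (Set.ne_univ_iff_exists_notMem _).1 (h x hx)
    obtain _ | m := n
    · exact t.elim0
    let δ : (FI.mk m : FI G) ⟶ FI.mk (m + 1) := (⟨t.succAboveEmb, fun _ => 1⟩ : FIHom G m (m + 1))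
    obtain ⟨y, rfl⟩ := X.exists_map_eq δ x fun s hs =>
      Fin.exists_succAbove_eq (x := s) (y := t) fun h => ht (h ▸ hs)
    have := map_mem_lower (X.lin k : FIMod.{u, v, w} k G) (Nat.lt_succ_self m) δ
      (Finsupp.single y (p (X.map δ y)))
    rwa [show ((X.lin k : FIMod.{u, v, w} k G).map δ).hom (Finsupp.single y (p (X.map δ y))) =
      Finsupp.single (X.map δ y) (p (X.map δ y)) from Finsupp.mapDomain_single] at this

/-- A retract of the linearization of a set-valued functor with supports. -/
def IsFreeRetract (P : FIMod.{u, v, w} k G) : Prop :=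
  ∃ (X : FISet.{v, max u v w} G) (i : P ⟶ X.lin k) (r : X.lin k ⟶ P), i ≫ r = 𝟙 P

lemma retract_apply {P F : FIMod.{u, v, w} k G} {i : P ⟶ F} {r : F ⟶ P} (h : i ≫ r = 𝟙 P)
    (n : FI G) (x : P.obj n) : (r.app n).hom ((i.app n).hom x) = x := by
  rw [← comp_app_hom, h]
  rfl

/-- A free module embeds into its shift. -/
lemma IsFreeRetract.toShift_injective {P : FIMod.{u, v, w} k G} (hP : IsFreeRetract P) (n : FI G) :
    Function.Injective ((toShift P).app n).hom := by
  obtain ⟨X, i, r, h⟩ := hP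
  have hX : Function.Injective ((toShift (X.lin k : FIMod.{u, v, w} k G)).app n).hom :=
    Finsupp.mapDomain_injective (X.map_injective (FI.incl n.card))
  intro x y hxy
  rw [← retract_apply h n x, ← retract_apply h n y]
  congr 1
  apply hX
  rw [← shiftMap_toShift, ← shiftMap_toShift, hxy]

/-- For free `P`, the map `H_0(P) ⟶ H_0(SP)` is injective. -/
lemma IsFreeRetract.mem_lower_of_toShift {P : FIMod.{u, v, w} k G} (hP : IsFreeRetract P) {n : ℕ}
    {x : P.obj ⟨n⟩} (hx : ((toShift P).app ⟨n⟩).hom x ∈ lower (shiftMod P) n) : x ∈ lower P n := by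
  classical
  obtain ⟨X, i, r, h⟩ := hP
  have hX : ∀ p : X.obj ⟨n⟩ →₀ k, ((toShift (X.lin k : FIMod.{u, v, w} k G)).app ⟨n⟩).hom p ∈
      lower (X.shift.lin k : FIMod.{u, v, w} k G) n →
        p ∈ lower (X.lin k : FIMod.{u, v, w} k G) n := by
    intro p hp
    have hp := FISet.mem_lower_lin.1 hp
    refine FISet.mem_lower_lin.2 fun x hx hsupp => hp (X.map (FI.incl n) x) ?_ ?_
    · change _ ∈ (Finsupp.mapDomain (X.map (FI.incl n)) p).support
      rw [Finsupp.mapDomain_support_of_injective (X.map_injective _)]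
      exact Finset.mem_image_of_mem _ hx
    · refine Set.eq_univ_of_forall fun t => ?_
      change Fin.succ t ∈ X.supp (X.map (FI.incl n) x)
      rw [X.supp_map, hsupp]
      exact ⟨t, trivial, rfl⟩
  rw [← retract_apply h _ x]
  refine app_mem_lower r (hX _ ?_)
  have := app_mem_lower (shiftMap i) hx
  exact (shiftMap_toShift i ⟨n⟩ x) ▸ this

lemma IsFreeRetract.shift {P : FIMod.{u, v, w} k G} (hP : IsFreeRetract P) :
    IsFreeRetract (shiftMod P) := by
  obtain ⟨X, i, r, h⟩ := hP
  exact ⟨X.shift, shiftMap i, shiftMap r, by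
    ext n x
    exact retract_apply h _ x⟩

/-- If `SP` is, up to the image of `P`, a retract of a module `F` such that `SP ⟶ F` kills `P`,
then `DP` is a retract of `F`. -/
lemma isFreeRetract_deriv_of_splitting {P F : FIMod.{u, v, w} k G} (hF : IsFreeRetract F)
    (q : shiftMod P ⟶ F) (j : F ⟶ shiftMod P)
    (hq : ∀ n x, (q.app n).hom (((toShift P).app n).hom x) = 0)
    (hj : ∀ n x, ∃ y, ((toShift P).app n).hom y = x - (j.app n).hom ((q.app n).hom x)) :
    IsFreeRetract (deriv P) := by
  obtain ⟨X, i, r, h⟩ := hF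
  let q' : deriv P ⟶ F :=
    { app := fun n => ModuleCat.ofHom (Submodule.liftQ _ (q.app n).hom (by
        rintro _ ⟨x, rfl⟩
        exact hq n x))
      naturality := fun m n a => by
        refine ModuleCat.hom_ext (LinearMap.ext fun p => ?_)
        obtain ⟨p, rfl⟩ := derivProj_surjective P m p
        exact app_map q a p }
  refine ⟨X, q' ≫ i, r ≫ j ≫ derivProj P, ?_⟩
  ext n x
  obtain ⟨x, rfl⟩ := derivProj_surjective P n x
  simp only [comp_app_hom, retract_apply h]
  refine (sub_eq_zero.1 ?_).symm
  change ((derivProj P).app n).hom x - ((derivProj P).app n).hom _ = 0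
  rw [← map_sub]
  exact derivProj_eq_zero.2 (hj n x)

lemma FISet.isFreeRetract_lin (X : FISet.{v, max u v w} G) :
    IsFreeRetract (X.lin k : FIMod.{u, v, w} k G) :=
  ⟨X, 𝟙 _, 𝟙 _, Category.comp_id _⟩

open Classical in
/-- The derivative of a linearization is the linearization of the derivative: the elements of
`X_{n+1}` that do not come from `X_n` form a subfunctor. -/
lemma FISet.isFreeRetract_deriv_lin (X : FISet.{v, max u v w} G) :
    IsFreeRetract (FIG.deriv (X.lin k : FIMod.{u, v, w} k G)) := by
  let q : X.shift.lin k ⟶ (X.deriv.lin k : FIMod.{u, v, w} k G) :=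
    FISet.desc (fun n x => if h : 0 ∈ X.suppShift x then X.deriv.single ⟨x, h⟩ 1 else 0)
      fun {m n} a x => by
        by_cases h : 0 ∈ X.suppShift x
        · rw [dif_pos h]
          exact (dif_pos ((X.zero_mem_suppShift_map a x).2 h)).trans (X.deriv.map_single a ⟨x, h⟩ 1).symm
        · rw [dif_neg h, map_zero]
          exact dif_neg fun h' => h ((X.zero_mem_suppShift_map a x).1 h')
  let j : X.deriv.lin k ⟶ (X.shift.lin k : FIMod.{u, v, w} k G) :=
    FISet.desc (fun n x => X.shift.single x.1 1) fun {m n} a x => (map_single _ _ _ _).symm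
  have hq0 : ∀ (n : FI G) (x : X.shift.obj n) (c : k), 0 ∉ X.suppShift x →
      (q.app n).hom (X.shift.single x c) = 0 := fun n x c h => by
    refine (desc_single _ _ _ x c).trans ?_
    rw [dif_neg h, smul_zero]
  refine isFreeRetract_deriv_of_splitting X.deriv.isFreeRetract_lin q j (fun n x => ?_)
    (fun n x => ?_)
  · induction x using lin_induction with
    | zero => simp only [map_zero]
    | add x y hx hy => rw [map_add, map_add, hx, hy, add_zero]
    | single x c =>
      rw [toShift_single]
      refine hq0 n _ c ?_
      rw [supp_toShift]
      rintro ⟨y, -, hy⟩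
      exact Fin.succ_ne_zero _ hy
  · refine lin_induction (X := X.shift) (p := fun x =>
      ∃ y, ((FIG.toShift (X.lin k)).app n).hom y = x - (j.app n).hom ((q.app n).hom x))
      ⟨0, ?_⟩ ?_ ?_ x
    · simp only [map_zero, sub_zero]
      rfl
    · rintro x y ⟨x', hx⟩ ⟨y', hy⟩
      refine ⟨x' + y', ?_⟩
      rw [map_add, hx, hy, map_add, map_add, add_sub_add_comm]
      rfl
    · intro x c
      by_cases h : 0 ∈ X.suppShift x
      · refine ⟨0, (map_zero _).trans (sub_eq_zero.2 ?_).symm⟩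
        have h1 : (q.app n).hom (X.shift.single x c) = c • X.deriv.single ⟨x, h⟩ 1 := by
          refine (desc_single _ _ _ x c).trans ?_
          rw [dif_pos h]
        have h2 : (j.app n).hom (X.deriv.single ⟨x, h⟩ (1 : k)) = (1 : k) • X.shift.single x 1 :=
          desc_single _ _ _ _ _
        rw [h1, map_smul, h2, one_smul]
        exact (Finsupp.smul_single_one x c).symm
      · rw [hq0 n x c h, map_zero, sub_zero]
        obtain ⟨y, rfl⟩ := X.exists_toShift_eq h
        exact ⟨_, X.toShift_single y c⟩

lemma IsFreeRetract.deriv {P : FIMod.{u, v, w} k G} (hP : IsFreeRetract P) :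
    IsFreeRetract (deriv P) := by
  obtain ⟨X, i, r, h⟩ := hP
  obtain ⟨Y, j, s, h'⟩ := X.isFreeRetract_deriv_lin (k := k)
  refine ⟨Y, derivMap i ≫ j, s ≫ derivMap r, ?_⟩
  ext n x
  obtain ⟨x, rfl⟩ := derivProj_surjective P n x
  simp only [comp_app_hom, retract_apply h', derivMap_derivProj]
  exact congrArg _ (retract_apply h _ x)

end Linearization

/-! ### Free covers and kernels -/

section Cover

variable {k : Type u} [CommRing k] {G : Type v} [Group G]

/-- The free module on all elements of `V`. -/
noncomputable abbrev cover (V : FIMod.{u, v, w} k G) : FIMod.{u, v, w} k G :=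
  (FISet.generators fun n => V.obj n).lin k

/-- The tautological epimorphism onto `V`. -/
noncomputable def coverπ (V : FIMod.{u, v, w} k G) : cover V ⟶ V :=
  FISet.desc (fun _ x => (V.map x.2.1).hom x.2.2) fun a x => map_comp_hom V x.2.1 a x.2.2

lemma coverπ_surjective (V : FIMod.{u, v, w} k G) (n : FI G) :
    Function.Surjective ((coverπ V).app n).hom := fun x => by
  let y : (FISet.generators fun n => V.obj n).obj n := ⟨n, 𝟙 n, x⟩
  refine ⟨FISet.single _ y 1, ?_⟩
  have := FISet.desc_single (FISet.generators fun n => V.obj n)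
    (fun _ x => (V.map x.2.1).hom x.2.2) (fun a x => map_comp_hom V x.2.1 a x.2.2) y 1
  refine this.trans ?_
  rw [one_smul]
  change (V.map (𝟙 n)).hom x = x
  rw [V.map_id]
  rfl

lemma isFreeRetract_of_projective (P : FIMod.{u, v, w} k G) [Projective P] :
    IsFreeRetract P := by
  have : Epi (coverπ P) := by
    have : ∀ n, Epi ((coverπ P).app n) := fun n =>
      (ModuleCat.epi_iff_surjective _).2 (coverπ_surjective P n)
    exact NatTrans.epi_of_epi_app _
  exact ⟨_, Projective.factorThru (𝟙 P) (coverπ P), coverπ P, Projective.factorThru_comp _ _⟩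

/-- The kernel of a morphism of `FI_G`-modules. -/
def kerMod {V W : FIMod.{u, v, w} k G} (φ : V ⟶ W) : FIMod.{u, v, w} k G where
  obj n := ModuleCat.of k (LinearMap.ker (φ.app n).hom)
  map {m n} a := ModuleCat.ofHom ((V.map a).hom.restrict fun x (hx : (φ.app m).hom x = 0) =>
    show (φ.app n).hom _ = 0 by rw [app_map, hx, map_zero])
  map_id n := by
    refine ModuleCat.hom_ext (LinearMap.ext fun x => Subtype.ext ?_)
    change (V.map (𝟙 n)).hom x.1 = x.1
    rw [V.map_id]
    rfl
  map_comp a b := by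
    refine ModuleCat.hom_ext (LinearMap.ext fun x => Subtype.ext ?_)
    exact map_comp_hom V a b x.1

/-- The inclusion of the kernel. -/
def kerι {V W : FIMod.{u, v, w} k G} (φ : V ⟶ W) : kerMod φ ⟶ V where
  app n := ModuleCat.ofHom (Submodule.subtype (LinearMap.ker (φ.app n).hom))
  naturality _ _ _ := rfl

lemma kerι_injective {V W : FIMod.{u, v, w} k G} (φ : V ⟶ W) (n : FI G) :
    Function.Injective ((kerι φ).app n).hom :=
  Subtype.val_injective

/-- The factorization through the kernel. -/
def kerLift {V W X : FIMod.{u, v, w} k G} (φ : V ⟶ W) (ψ : X ⟶ V)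
    (h : ∀ n x, (φ.app n).hom ((ψ.app n).hom x) = 0) : X ⟶ kerMod φ where
  app n := ModuleCat.ofHom ((ψ.app n).hom.codRestrict _ (h n))
  naturality m n a := by
    refine ModuleCat.hom_ext (LinearMap.ext fun x => Subtype.ext ?_)
    exact app_map ψ a x

end Cover

/-! ### Right exact sequences and derivatives -/

section RightExact

variable {k : Type u} [CommRing k] {G : Type v} [Group G]

/-- Exactness of `Z ⟶ P ⟶ V ⟶ 0`, in terms of elements. -/
structure IsRightExact {Z P V : FIMod.{u, v, w} k G} (f : Z ⟶ P) (e : P ⟶ V) : Prop where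
  surjective : ∀ n, Function.Surjective (e.app n).hom
  zero : ∀ n x, (e.app n).hom ((f.app n).hom x) = 0
  exact : ∀ n x, (e.app n).hom x = 0 → ∃ z, (f.app n).hom z = x

lemma isRightExact_kerι {P V : FIMod.{u, v, w} k G} (e : P ⟶ V)
    (he : ∀ n, Function.Surjective (e.app n).hom) : IsRightExact (kerι e) e :=
  ⟨he, fun _ x => x.2, fun _ x hx => ⟨⟨x, hx⟩, rfl⟩⟩

variable {Z P V : FIMod.{u, v, w} k G} {f : Z ⟶ P} {e : P ⟶ V}

lemma IsRightExact.deriv (h : IsRightExact f e) : IsRightExact (derivMap f) (derivMap e) where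
  surjective n y := by
    obtain ⟨y, rfl⟩ := derivProj_surjective V n y
    obtain ⟨x, hx⟩ := h.surjective ((FI.shift G).obj n) y
    exact ⟨((derivProj P).app n).hom x, congrArg ((derivProj V).app n).hom hx⟩
  zero n z := by
    obtain ⟨z, rfl⟩ := derivProj_surjective Z n z
    rw [derivMap_derivProj, derivMap_derivProj]
    exact (congrArg ((derivProj V).app n).hom (h.zero ((FI.shift G).obj n) z)).trans (map_zero _)
  exact n x hx := by
    obtain ⟨x, rfl⟩ := derivProj_surjective P n x
    rw [derivMap_derivProj] at hx
    obtain ⟨v, hv⟩ := derivProj_eq_zero.1 hx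
    obtain ⟨p, rfl⟩ := h.surjective n v
    obtain ⟨z, hz⟩ := h.exact ((FI.shift G).obj n) (x - ((toShift P).app n).hom p)
      ((map_sub ((shiftMap e).app n).hom _ _).trans
        (by rw [shiftMap_toShift, hv, sub_self]))
    refine ⟨((derivProj Z).app n).hom z, ?_⟩
    rw [derivMap_derivProj]
    refine (congrArg ((derivProj P).app n).hom hz).trans ?_
    rw [map_sub, derivProj_eq_zero.2 ⟨p, rfl⟩, sub_zero]

/-- The snake lemma for `0 ⟶ KV ⟶ DZ ⟶ DP`, in one degree. -/
lemma IsRightExact.derivMap_injective (h : IsRightExact f e) {n : ℕ}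
    (hf : Function.Injective (f.app ⟨n + 1⟩).hom)
    (hV : ∀ x, ((toShift V).app ⟨n⟩).hom x = 0 → x = 0) :
    Function.Injective ((derivMap f).app ⟨n⟩).hom := by
  rw [injective_iff_map_eq_zero]
  intro z hz
  obtain ⟨z, rfl⟩ := derivProj_surjective Z _ z
  rw [derivMap_derivProj] at hz
  obtain ⟨p, hp⟩ := derivProj_eq_zero.1 hz
  obtain ⟨z', rfl⟩ := h.exact _ p (hV _ (by
    rw [← shiftMap_toShift, hp]
    exact h.zero ⟨n + 1⟩ z))
  exact derivProj_eq_zero.2 ⟨z', hf ((shiftMap_toShift f _ z').trans hp)⟩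

end RightExact

/-! ### Torsion bounds and syzygies -/

section Torsion

variable {k : Type u} [CommRing k] {G : Type v} [Group G]

/-- The iterated derivative `D^a V`. -/
def iterDeriv : ℕ → FIMod.{u, v, w} k G → FIMod.{u, v, w} k G
  | 0, V => V
  | a + 1, V => iterDeriv a (deriv V)

/-- The kernel of `D^a V ⟶ S D^a V` vanishes in all degrees `n` with `n + a > ρ`. -/
def TorsionBound (ρ : ℤ) (V : FIMod.{u, v, w} k G) : Prop :=
  ∀ a n : ℕ, ρ < n + a → ∀ x, ((toShift (iterDeriv a V)).app ⟨n⟩).hom x = 0 → x = 0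

lemma TorsionBound.deriv {ρ : ℤ} {V : FIMod.{u, v, w} k G} (h : TorsionBound ρ V) :
    TorsionBound (ρ - 1) (deriv V) :=
  fun a n hn => h (a + 1) n (by push_cast; omega)

lemma TorsionBound.of_deriv {ρ σ : ℤ} {V : FIMod.{u, v, w} k G} (h : TorsionBound σ (FIG.deriv V))
    (hσ : σ < ρ) (h0 : ∀ n : ℕ, ρ < n → ∀ x, ((toShift V).app ⟨n⟩).hom x = 0 → x = 0) :
    TorsionBound ρ V
  | 0, n, hn => h0 n (by simpa using hn)
  | a + 1, n, hn => h a n (by push_cast at hn; omega)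

variable {Z P V : FIMod.{u, v, w} k G} {f : Z ⟶ P} {e : P ⟶ V} {ρ : ℤ}

/-- Passing from `V` to its first syzygy `Z` increases a torsion bound by one. The hypothesis of
injectivity (instead of `f` being a monomorphism) is what is inherited by
`DZ ⟶ DP ⟶ DV ⟶ 0`. -/
lemma TorsionBound.syzygy (h : IsRightExact f e) (hP : IsFreeRetract P) (hV : TorsionBound ρ V)
    (hf : ∀ n : ℕ, ρ + 1 < n → Function.Injective (f.app ⟨n⟩).hom) : TorsionBound (ρ + 1) Z := by
  intro a
  induction a generalizing Z P V ρ with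
  | zero =>
    intro n hn (x : Z.obj ⟨n⟩) hx
    refine (injective_iff_map_eq_zero _).1 (hf n (by simpa using hn)) x
      ((injective_iff_map_eq_zero _).1 (hP.toShift_injective ⟨n⟩) _ ?_)
    rw [← shiftMap_toShift, show ((toShift Z).app ⟨n⟩).hom x = 0 from hx, map_zero]
  | succ a ih =>
    intro n hn
    refine ih (ρ := ρ - 1) h.deriv hP.deriv hV.deriv (fun m hm => ?_) n (by push_cast at hn; omega)
    exact h.derivMap_injective (hf _ (by push_cast; omega)) (hV 0 m (by push_cast; omega))

/-- A torsion bound for `V` bounds the degree of `H_1(V) = ker (H_0(Z) ⟶ H_0(P))`: this follows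
from the injectivity of `D^n Z ⟶ D^n P` in degree `0`, since `H_0(Z)_n = (D^n Z)_0`. -/
lemma TorsionBound.mem_lower (h : IsRightExact f e) (hV : TorsionBound ρ V)
    (hf : ∀ n : ℕ, ρ + 1 < n → Function.Injective (f.app ⟨n⟩).hom) {n : ℕ} (hn : ρ + 1 < n)
    {z : Z.obj ⟨n⟩} (hz : (f.app ⟨n⟩).hom z ∈ lower P n) : z ∈ lower Z n := by
  induction n generalizing Z P V ρ with
  | zero =>
    rw [lower_zero, Submodule.mem_bot] at hz
    rw [(injective_iff_map_eq_zero _).1 (hf 0 hn) z hz]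
    exact zero_mem _
  | succ n ih =>
    refine derivProj_mem_lower.1 (ih (ρ := ρ - 1) h.deriv hV.deriv (fun m hm => ?_)
      (by push_cast at hn; omega) (z := ((derivProj Z).app ⟨n⟩).hom z) ?_)
    · exact h.derivMap_injective (hf _ (by push_cast; omega)) (hV 0 m (by push_cast; omega))
    · exact derivProj_mem_lower.2 hz

lemma eq_zero_of_lower_eq_top {V : FIMod.{u, v, w} k G} (h : ∀ n x, x ∈ lower V n) (n : ℕ)
    (x : V.obj ⟨n⟩) : x = 0 := by
  induction n using Nat.strong_induction_on with
  | _ n ih =>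
    have : lower V n ≤ ⊥ := lower_le fun i hi a y => by
      rw [ih i hi y, map_zero]
      exact zero_mem _
    exact this (h n x)

lemma mem_lower_deriv {V : FIMod.{u, v, w} k G} {n : ℕ} (h : ∀ x, x ∈ lower V (n + 1))
    (x : (deriv V).obj ⟨n⟩) : x ∈ lower (deriv V) n := by
  obtain ⟨x, rfl⟩ := derivProj_surjective V _ x
  exact derivProj_mem_lower.2 (h x)

lemma torsionBound_of_lower_eq_top {V : FIMod.{u, v, w} k G} (h : ∀ n x, x ∈ lower V n) (ρ : ℤ) :
    TorsionBound ρ V := by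
  intro a
  induction a generalizing V ρ with
  | zero => exact fun n _ x _ => eq_zero_of_lower_eq_top h n x
  | succ a ih =>
    exact fun n hn => ih (fun m => mem_lower_deriv (h (m + 1))) (ρ - 1) n (by push_cast at hn; omega)

/-- A morphism with values in the kernel of `V ⟶ SV` factors through `H_0`. -/
lemma app_eq_zero_of_mem_lower {W V : FIMod.{u, v, w} k G} (φ : W ⟶ V)
    (h : ∀ n x, ((toShift V).app n).hom ((φ.app n).hom x) = 0) {n : ℕ} {x : W.obj ⟨n⟩}
    (hx : x ∈ lower W n) : (φ.app ⟨n⟩).hom x = 0 := by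
  have : lower W n ≤ LinearMap.ker (φ.app ⟨n⟩).hom := lower_le fun i hi a y => by
    rw [LinearMap.mem_ker, app_map]
    exact map_eq_zero_of_toShift hi a (h ⟨i⟩ y)
  exact this hx

end Torsion

/-! ### Torsion bounds from generators and relations -/

section Presentation

variable {k : Type u} [CommRing k] {G : Type v} [Group G]

/-- `A ⟶ P ⟶ V ⟶ 0` is a presentation with `P` free in which every relation in degree `n > r` that
is decomposable in `P` is decomposable as a relation. If `Z` is the image of `A` in `P`, this says
that `H_0(Z)_n ⟶ H_0(P)_n` is injective, so that `H_1(V)_n = 0`, for `n > r`. It is stated in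
terms of `A`, since `A_{<n}` maps onto `Z_{<n}`. -/
structure IsPresentation (r : ℤ) {A P V : FIMod.{u, v, w} k G} (f : A ⟶ P) (e : P ⟶ V) : Prop
    extends IsRightExact f e where
  free : IsFreeRetract P
  relations : ∀ n : ℕ, r < n → ∀ a, (f.app ⟨n⟩).hom a ∈ lower P n →
    ∃ a' ∈ lower A n, (f.app ⟨n⟩).hom a' = (f.app ⟨n⟩).hom a

section Biproduct

variable (V W : FIMod.{u, v, w} k G)

/-- The first inclusion into `V ⊞ W`. -/
noncomputable abbrev inlMod : V ⟶ V ⊞ W := biprod.inl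

/-- The second inclusion into `V ⊞ W`. -/
noncomputable abbrev inrMod : W ⟶ V ⊞ W := biprod.inr

/-- The first projection of `V ⊞ W`. -/
noncomputable abbrev fstMod : V ⊞ W ⟶ V := biprod.fst

/-- The second projection of `V ⊞ W`. -/
noncomputable abbrev sndMod : V ⊞ W ⟶ W := biprod.snd

variable {V W}

lemma biprod_eta (n : FI G) (x : (V ⊞ W).obj n) :
    ((inlMod V W).app n).hom (((fstMod V W).app n).hom x) +
      ((inrMod V W).app n).hom (((sndMod V W).app n).hom x) = x :=
  congrArg (fun φ : V ⊞ W ⟶ V ⊞ W => (φ.app n).hom x) biprod.total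

lemma snd_inl_apply (n : FI G) (x : V.obj n) :
    ((sndMod V W).app n).hom (((inlMod V W).app n).hom x) = 0 :=
  congrArg (fun χ : V ⟶ W => (χ.app n).hom x) biprod.inl_snd

lemma snd_inr_apply (n : FI G) (x : W.obj n) :
    ((sndMod V W).app n).hom (((inrMod V W).app n).hom x) = x :=
  congrArg (fun χ : W ⟶ W => (χ.app n).hom x) biprod.inr_snd

variable {X : FIMod.{u, v, w} k G} (φ : V ⟶ X) (ψ : W ⟶ X)

lemma biprod_desc_inl (n : FI G) (x : V.obj n) :
    ((biprod.desc φ ψ).app n).hom (((inlMod V W).app n).hom x) = (φ.app n).hom x :=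
  congrArg (fun χ : V ⟶ X => (χ.app n).hom x) (biprod.inl_desc φ ψ)

lemma biprod_desc_inr (n : FI G) (x : W.obj n) :
    ((biprod.desc φ ψ).app n).hom (((inrMod V W).app n).hom x) = (ψ.app n).hom x :=
  congrArg (fun χ : W ⟶ X => (χ.app n).hom x) (biprod.inr_desc φ ψ)

lemma biprod_desc_apply (n : FI G) (x : (V ⊞ W).obj n) :
    ((biprod.desc φ ψ).app n).hom x = (φ.app n).hom (((fstMod V W).app n).hom x) +
      (ψ.app n).hom (((sndMod V W).app n).hom x) := by
  conv_lhs => rw [← biprod_eta n x]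
  rw [map_add, biprod_desc_inl, biprod_desc_inr]

end Biproduct

variable {A P V : FIMod.{u, v, w} k G} {f : A ⟶ P} {e : P ⟶ V} {r : ℤ}

/-- A relation of degree `n + 1 > r` that is decomposable in `P` is the sum of a relation that is
decomposable in `SA` and of one that comes from degree `n`. -/
lemma IsPresentation.exists_lower_shift (h : IsPresentation r f e) {n : ℕ} (hn : r < n + 1)
    {s : (shiftMod A).obj ⟨n⟩} (hs : ((shiftMap f).app ⟨n⟩).hom s ∈ lowerShift P n) :
    ∃ s' ∈ lower (shiftMod A) n, ∃ a, ((shiftMap f).app ⟨n⟩).hom s =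
      ((shiftMap f).app ⟨n⟩).hom s' + ((toShift P).app ⟨n⟩).hom ((f.app ⟨n⟩).hom a) := by
  obtain ⟨s', hs', hss⟩ := h.relations (n + 1) (by push_cast; exact hn) s hs
  obtain ⟨s'', hs'', a, rfl⟩ := mem_lowerShift.1 hs'
  refine ⟨s'', hs'', a, hss.symm.trans ?_⟩
  rw [← shiftMap_toShift]
  exact map_add ((shiftMap f).app ⟨n⟩).hom _ _

/-- A presentation `A ⟶ P` of `V` gives the presentation `SA ⊕ P ⟶ SP` of `DV`. -/
lemma IsPresentation.deriv (h : IsPresentation r f e) :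
    IsPresentation (r - 1) (biprod.desc (shiftMap f) (toShift P)) (shiftMap e ≫ derivProj V) where
  surjective n y := by
    obtain ⟨y, rfl⟩ := derivProj_surjective V n y
    obtain ⟨x, hx⟩ := h.surjective ((FI.shift G).obj n) y
    exact ⟨x, congrArg ((derivProj V).app n).hom hx⟩
  zero n x := by
    rw [biprod_desc_apply, comp_app_hom, map_add, map_add, shiftMap_toShift,
      derivProj_eq_zero.2 ⟨_, rfl⟩, add_zero]
    exact (congrArg ((derivProj V).app n).hom (h.zero ((FI.shift G).obj n) _)).trans (map_zero _)
  exact n x hx := by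
    obtain ⟨v, hv⟩ := derivProj_eq_zero.1 hx
    obtain ⟨p, rfl⟩ := h.surjective n v
    obtain ⟨z, hz⟩ := h.exact ((FI.shift G).obj n) (x - ((toShift P).app n).hom p)
      ((map_sub ((shiftMap e).app n).hom _ _).trans
        (by rw [shiftMap_toShift, hv]; exact sub_self _))
    refine ⟨((inlMod (shiftMod A) P).app n).hom z + ((inrMod (shiftMod A) P).app n).hom p, ?_⟩
    rw [map_add, biprod_desc_inl, biprod_desc_inr]
    exact eq_sub_iff_add_eq.1 hz
  free := h.free.shift
  relations n hn b hb := by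
    rw [biprod_desc_apply] at hb ⊢
    set s := ((fstMod (shiftMod A) P).app ⟨n⟩).hom b
    set p := ((sndMod (shiftMod A) P).app ⟨n⟩).hom b
    obtain ⟨s', hs', a, hss⟩ := h.exists_lower_shift (s := s) (by omega) (by
      rw [lowerShift_eq]
      have := Submodule.add_mem_sup hb
        (LinearMap.mem_range_self ((toShift P).app ⟨n⟩).hom (-p))
      rwa [map_neg, add_neg_cancel_right] at this)
    rw [hss, add_assoc, ← map_add] at hb ⊢
    have hp := h.free.mem_lower_of_toShift
      ((Submodule.add_mem_iff_right _ (app_mem_lower (shiftMap f) hs')).1 hb)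
    refine ⟨_, add_mem (app_mem_lower (inlMod (shiftMod A) P) hs')
      (app_mem_lower (inrMod (shiftMod A) P) hp), ?_⟩
    rw [map_add, biprod_desc_inl, biprod_desc_inr]

/-- The torsion of `V` is bounded by a torsion bound for `DV`. Indeed, up to terms that vanish in
the degrees considered, a torsion element of `V` in degree `n` comes from `H_2(DV)_n`; a
representative of this class that is decomposable maps to zero in `V`, because the transition
maps kill torsion. -/
lemma IsPresentation.eq_zero_of_toShift (h : IsPresentation r f e) {ρ : ℤ}
    (hT : TorsionBound (ρ - 2) (FIG.deriv V)) {n : ℕ} (hr : r ≤ n) (hρ : ρ < n) (x : V.obj ⟨n⟩)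
    (hx : ((toShift V).app ⟨n⟩).hom x = 0) : x = 0 := by
  obtain ⟨x, rfl⟩ := h.surjective _ x
  have hlow : ∀ p, ((toShift P).app ⟨n⟩).hom p ∈ lowerShift P n := toShift_mem_lowerShift P
  obtain ⟨s, hs⟩ := h.exact ⟨n + 1⟩ (((toShift P).app ⟨n⟩).hom x)
    ((shiftMap_toShift e ⟨n⟩ x).trans hx)
  replace hs : ((shiftMap f).app ⟨n⟩).hom s = ((toShift P).app ⟨n⟩).hom x := hs
  obtain ⟨s', hs', a, hss⟩ := h.exists_lower_shift (s := s) (by omega) (hs ▸ hlow x)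
  -- after a modification by a relation, `x` is decomposable
  obtain ⟨y, hy⟩ : ∃ y, y = x - (f.app ⟨n⟩).hom a := ⟨_, rfl⟩
  have hey : (e.app ⟨n⟩).hom x = (e.app ⟨n⟩).hom y := by rw [hy, map_sub, h.zero, sub_zero]
  have hys : ((toShift P).app ⟨n⟩).hom y = ((shiftMap f).app ⟨n⟩).hom s' := by
    rw [hy, map_sub, ← hs, hss, add_sub_cancel_right]
  have hylow : y ∈ lower P n :=
    h.free.mem_lower_of_toShift (hys ▸ app_mem_lower (shiftMap f) hs')
  rw [hey]
  have h' := h.deriv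
  let f' : shiftMod A ⊞ P ⟶ shiftMod P := biprod.desc (shiftMap f) (toShift P)
  let e' := shiftMap e ≫ derivProj V
  -- the beginning of a free resolution of `DV`, and its syzygies
  let Q := cover (shiftMod A ⊞ P)
  let π : Q ⟶ shiftMod A ⊞ P := coverπ _
  let g : Q ⟶ kerMod e' := kerLift e' (π ≫ f') fun m q => h'.zero m _
  have hg : ∀ m, Function.Surjective (g.app m).hom := fun m z => by
    obtain ⟨b, hb⟩ := h'.exact m z.1 z.2
    obtain ⟨q, rfl⟩ := coverπ_surjective _ m b
    exact ⟨q, kerι_injective e' m hb⟩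
  have hT' : TorsionBound (ρ - 2 + 1) (kerMod e') :=
    hT.syzygy (isRightExact_kerι e' h'.surjective) h'.free fun m _ => kerι_injective e' _
  -- the morphism from the second syzygy to `V` takes torsion values
  let θ : kerMod g ⟶ V := kerι g ≫ π ≫ sndMod (shiftMod A) P ≫ e
  have hθ : ∀ m z, ((toShift V).app m).hom ((θ.app m).hom z) = 0 := fun m z => by
    have h0 : ((kerι e').app m).hom ((g.app m).hom (((kerι g).app m).hom z)) = 0 := by
      rw [show (g.app m).hom (((kerι g).app m).hom z) = 0 from z.2, map_zero]
    have h1 : (f'.app m).hom ((π.app m).hom (((kerι g).app m).hom z)) = 0 := h0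
    rw [biprod_desc_apply] at h1
    replace h1 := congrArg ((shiftMap e).app m).hom h1
    rw [map_add, shiftMap_toShift, map_zero] at h1
    refine Eq.trans ?_ h1
    refine ((zero_add _).symm.trans ?_)
    exact congrArg (· + _) (h.zero ((FI.shift G).obj m) _).symm
  obtain ⟨q, hq, hqb⟩ := exists_lower_lift π (coverπ_surjective _)
    (sub_mem (app_mem_lower (inlMod (shiftMod A) P) hs')
      (app_mem_lower (inrMod (shiftMod A) P) hylow))
  have hgq : (g.app ⟨n⟩).hom q = 0 := kerι_injective e' _ (by
    refine Eq.trans ?_ (map_zero _).symm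
    change (f'.app ⟨n⟩).hom ((π.app ⟨n⟩).hom q) = 0
    rw [hqb, map_sub, biprod_desc_inl, biprod_desc_inr, hys, sub_self])
  have hz := hT'.mem_lower (isRightExact_kerι g hg) (fun m _ => kerι_injective g _)
    (by omega) (z := (⟨q, hgq⟩ : (kerMod g).obj ⟨n⟩)) hq
  have := app_eq_zero_of_mem_lower θ hθ hz
  replace this : (e.app ⟨n⟩).hom (((sndMod (shiftMod A) P).app ⟨n⟩).hom ((π.app ⟨n⟩).hom q)) = 0 :=
    this
  rwa [hqb, map_sub, snd_inl_apply, snd_inr_apply, zero_sub, map_neg, neg_eq_zero] at this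

/-- The torsion bound for a module generated in degrees `< d` with relations in degrees `≤ r`. -/
lemma IsPresentation.torsionBound (h : IsPresentation r f e) {d : ℕ}
    (hd : ∀ n, d ≤ n → ∀ x, x ∈ lower V n) : TorsionBound (r + min r (d - 1) - 1) V := by
  induction d generalizing r A P V with
  | zero => exact torsionBound_of_lower_eq_top (fun n => hd n (Nat.zero_le n)) _
  | succ d ih =>
    have hT := ih h.deriv fun n hn => mem_lower_deriv (hd (n + 1) (Nat.succ_le_succ hn))
    rw [show r - 1 + min (r - 1) ((d : ℤ) - 1) - 1 =
      r + min r (((d + 1 : ℕ) : ℤ) - 1) - 1 - 2 by push_cast; omega] at hT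
    refine hT.of_deriv (by omega) fun n hn => h.eq_zero_of_toShift hT ?_ hn
    push_cast at hn
    omega

end Presentation

/-! ### Derived functors in terms of elements -/

section Derived

variable {k : Type u} [CommRing k] {G : Type v} [Group G]

lemma exists_of_exact {S : ShortComplex (FIMod.{u, v, w} k G)} (hS : S.Exact) (n : FI G) :
    ∀ x, (S.g.app n).hom x = 0 → ∃ y, (S.f.app n).hom y = x :=
  (ShortComplex.moduleCat_exact_iff _).1
    (hS.map ((evaluation (FI G) (ModuleCat.{max u v w} k)).obj n))

lemma subsingleton_homology_iff (K : ChainComplex (FBMod.{u, v, w} k G) ℕ) (p : ℕ) (n : FB G) :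
    Subsingleton ((K.homology (p + 1)).obj n) ↔
      ∀ x, ((K.d (p + 1) p).app n).hom x = 0 → ∃ y, ((K.d (p + 2) (p + 1)).app n).hom y = x := by
  let F := (evaluation (FB G) (ModuleCat.{max u v w} k)).obj n
  let S := K.sc' (p + 2) (p + 1) p
  have i : (S.map F).homology ≅ (K.homology (p + 1)).obj n :=
    S.mapHomologyIso F ≪≫ F.mapIso (K.homologyIsoSc' (p + 2) (p + 1) p (by simp) (by simp)).symm
  rw [← ModuleCat.isZero_iff_subsingleton, ← i.isZero_iff, ← ShortComplex.exact_iff_isZero_homology]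
  exact ShortComplex.moduleCat_exact_iff _

/-- The vanishing of `H_{p+1}(V)_n`, in terms of a projective resolution of `V`. -/
lemma subsingleton_homology_obj_iff {V : FIMod.{u, v, w} k G} (R : ProjectiveResolution V)
    (p n : ℕ) : Subsingleton (((homology.{u, v, w} k G (p + 1)).obj V).obj ⟨n⟩) ↔
      ∀ x, ((R.complex.d (p + 1) p).app ⟨n⟩).hom x ∈ lower (R.complex.X p) n →
        ∃ y, x - ((R.complex.d (p + 2) (p + 1)).app ⟨n⟩).hom y ∈
          lower (R.complex.X (p + 1)) n := by
  have i := ((evaluation (FB G) (ModuleCat.{max u v w} k)).obj ⟨n⟩).mapIso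
    (R.isoLeftDerivedObj (H0.{u, v, w} k G) (p + 1))
  rw [← ModuleCat.isZero_iff_subsingleton]
  refine i.isZero_iff.trans (ModuleCat.isZero_iff_subsingleton.trans
    ((subsingleton_homology_iff _ p ⟨n⟩).trans ?_))
  constructor
  · intro h x hx
    obtain ⟨y, hy⟩ := h (Submodule.Quotient.mk x) ((Submodule.Quotient.mk_eq_zero _).2 hx)
    obtain ⟨y, rfl⟩ := Submodule.Quotient.mk_surjective _ y
    exact ⟨y, (Submodule.Quotient.eq _).1 hy.symm⟩
  · intro h x hx
    obtain ⟨x, rfl⟩ := Submodule.Quotient.mk_surjective _ x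
    obtain ⟨y, hy⟩ := h x ((Submodule.Quotient.mk_eq_zero _).1 hx)
    exact ⟨Submodule.Quotient.mk y, ((Submodule.Quotient.eq _).2 hy).symm⟩

lemma degree_le_iff (W : FBMod.{u, v, w} k G) (N : ℤ) :
    degree W ≤ ((N : ℝ) : EReal) ↔ ∀ n : ℕ, N < n → Subsingleton (W.obj ⟨n⟩) := by
  have cast : ∀ n : ℕ, (n : EReal) ≤ ((N : ℝ) : EReal) ↔ (n : ℤ) ≤ N := fun n => by
    rw [← EReal.coe_coe_eq_natCast, EReal.coe_le_coe_iff]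
    exact_mod_cast Iff.rfl
  simp only [degree, iSup_le_iff, cast]
  refine forall_congr' fun n => ?_
  rw [← not_nontrivial_iff_subsingleton, ← not_le, not_imp_not]

end Derived

/-! ### Projective resolutions -/

section Resolution

variable {k : Type u} [CommRing k] {G : Type v} [Group G]

variable {V : FIMod.{u, v, w} k G} (R : ProjectiveResolution V)

lemma d_comp_d_apply (K : ChainComplex (FIMod.{u, v, w} k G) ℕ) (p : ℕ) (n : FI G)
    (x : (K.X (p + 2)).obj n) :
    ((K.d (p + 1) p).app n).hom (((K.d (p + 2) (p + 1)).app n).hom x) = 0 :=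
  congrArg (fun φ : K.X (p + 2) ⟶ K.X p => (φ.app n).hom x) (K.d_comp_d _ _ _)

/-- The augmentation of a projective resolution. -/
noncomputable abbrev augmentation : R.complex.X 0 ⟶ V := R.π.f 0

lemma isRightExact_resolution : IsRightExact (R.complex.d 1 0) (augmentation R) where
  surjective n := app_surjective (R.π.f 0) n
  zero n x := congrArg (fun φ : R.complex.X 1 ⟶ V => (φ.app n).hom x) R.complex_d_comp_π_f_zero
  exact n := exists_of_exact R.exact₀ n

/-- The start of a projective resolution is a presentation with relations in degrees up to the
degree of `H_1(V)`. -/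
lemma isPresentation_resolution {r : ℤ}
    (h : ∀ n : ℕ, r < n → Subsingleton (((homology.{u, v, w} k G 1).obj V).obj ⟨n⟩)) :
    IsPresentation r (R.complex.d 1 0) (augmentation R) where
  toIsRightExact := isRightExact_resolution R
  free := isFreeRetract_of_projective _
  relations n hn a ha := by
    obtain ⟨y, hy⟩ := (subsingleton_homology_obj_iff R 0 n).1 (h n hn) a ha
    exact ⟨_, hy, by rw [map_sub, d_comp_d_apply, sub_zero]⟩

/-- All syzygies of `V` satisfy a torsion bound. -/
lemma exists_syzygy {ρ : ℤ} (hV : TorsionBound ρ V) (p : ℕ) :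
    ∃ (Z : FIMod.{u, v, w} k G) (e : R.complex.X p ⟶ Z),
      IsRightExact (R.complex.d (p + 1) p) e ∧ TorsionBound (ρ + p) Z := by
  induction p with
  | zero => exact ⟨V, augmentation R, isRightExact_resolution R, by simpa using hV⟩
  | succ p ih =>
    obtain ⟨Z, e, he, hZ⟩ := ih
    refine ⟨kerMod e, kerLift e (R.complex.d (p + 1) p) he.zero, ⟨?_, ?_, ?_⟩, ?_⟩
    · intro n z
      obtain ⟨x, hx⟩ := he.exact n z.1 z.2
      exact ⟨x, kerι_injective e n hx⟩
    · intro n x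
      exact kerι_injective e n (d_comp_d_apply R.complex p n x)
    · intro n x hx
      exact exists_of_exact (R.exact_succ p) n x (congrArg ((kerι e).app n).hom hx)
    · have := hZ.syzygy (isRightExact_kerι e he.surjective) (isFreeRetract_of_projective _)
        fun m _ => kerι_injective e _
      rwa [add_assoc] at this

lemma TorsionBound.subsingleton_homology {ρ : ℤ} (hV : TorsionBound ρ V) (p n : ℕ)
    (hn : ρ + (p + 1) < n) :
    Subsingleton (((homology.{u, v, w} k G (p + 1)).obj V).obj ⟨n⟩) := by
  obtain ⟨R⟩ : Nonempty (ProjectiveResolution V) := HasProjectiveResolution.out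
  rw [subsingleton_homology_obj_iff R]
  intro x hx
  obtain ⟨Z, e, he, hZ⟩ := exists_syzygy R hV p
  let e' := kerLift e (R.complex.d (p + 1) p) he.zero
  have he' : ∀ m, Function.Surjective (e'.app m).hom := fun m z => by
    obtain ⟨x, hx⟩ := he.exact m z.1 z.2
    exact ⟨x, kerι_injective e m hx⟩
  have hz := hZ.mem_lower (isRightExact_kerι e he.surjective) (fun m _ => kerι_injective e _)
    (by omega) (z := (e'.app ⟨n⟩).hom x) hx
  obtain ⟨x', hx', hxx⟩ := exists_lower_lift e' he' hz
  obtain ⟨y, hy⟩ := exists_of_exact (R.exact_succ p) ⟨n⟩ (x - x') (by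
    change ((R.complex.d (p + 1) p).app ⟨n⟩).hom (x - x') = 0
    rw [map_sub]
    exact sub_eq_zero.2 (congrArg ((kerι e).app ⟨n⟩).hom hxx).symm)
  refine ⟨y, ?_⟩
  replace hy : ((R.complex.d (p + 2) (p + 1)).app ⟨n⟩).hom y = x - x' := hy
  rwa [hy, sub_sub_cancel]

end Resolution

end FIG

theorem theoremA {k : Type u} [CommRing k] {G : Type v} [Group G]
    (V : FIG.FIMod.{u, v, w} k G) (d r : ℤ)
    (hd : FIG.generatingDegree V ≤ ((d : ℝ) : EReal))
    (hr : FIG.homologicalDegree V 1 ≤ ((r : ℝ) : EReal)) :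
    FIG.regularity V ≤ (((r + min r d - 1 : ℤ) : ℝ) : EReal) := by
  obtain ⟨R⟩ : Nonempty (ProjectiveResolution V) := HasProjectiveResolution.out
  have hd' : ∀ n : ℕ, d < n → ∀ x, x ∈ FIG.lower V n := fun n hn x =>
    (Submodule.Quotient.mk_eq_zero _).1
      (((FIG.degree_le_iff _ d).1 hd n hn).elim (Submodule.Quotient.mk x) 0)
  have hP := FIG.isPresentation_resolution R ((FIG.degree_le_iff _ r).1 hr)
  have hT : FIG.TorsionBound (r + min r d - 1) V := by
    rcases lt_or_ge d 0 with h | h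
    · exact FIG.torsionBound_of_lower_eq_top (fun n => hd' n (by omega)) _
    · have := hP.torsionBound (d := (d + 1).toNat) fun n hn => hd' n (by omega)
      rwa [Int.toNat_of_nonneg (by omega), add_sub_cancel_right] at this
  refine iSup₂_le fun i hi => ?_
  obtain ⟨p, rfl⟩ := Nat.exists_eq_add_of_le' hi
  have key : FIG.homologicalDegree V (p + 1) ≤ (((r + min r d - 1 + (p + 1) : ℤ) : ℝ) : EReal) :=
    (FIG.degree_le_iff _ _).2 fun n hn => hT.subsingleton_homology p n hn
  refine EReal.sub_le_of_le_add (key.trans (le_of_eq ?_))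
  rw [← EReal.coe_coe_eq_natCast, ← EReal.coe_add]
  push_cast
  rfl
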